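/- Consider a family of real-valued feed-forward networks on an input space $\mathcal X$ with the same number $L\ge 1$ of hidden layers. Hidden layer $\ell$ has $d^\ell$ units and its own parameters $\theta^\ell$, and its output is a function, measurable in the parameters, of $\theta^\ell$, of the network input and of the outputs of the preceding hidden layers. Write $d_{\min}=\min_{1\le \ell\le L} d^\ell$; the family contains networks with arbitrarily large $d_{\min}$. If $h^L(x)\in\mathbb R^{d^L}$ is the output of the last hidden layer, then the network computes $f_\theta(x)=\frac{\sigma_w}{\sqrt{d^L}}\,h^L(x)^\top\theta^{L+1}$ with readout weights $\theta^{L+1}\in\mathbb R^{d^L}$ and a constant $\sigma_w$; $\theta\in\mathbb R^d$ is the vector of all parameters. Fix inputs $X=(x_1,\dots,x_n)\in\mathcal X^n$, targets $y\in\mathbb R^n$ and $\sigma>0$. The prior is $\theta\sim\mathcal N(0,I_d)$, and the posterior $P_{\theta\mid\mathcal D}$ is the probability measure whose density with respect to the prior is proportional to $\exp\{-\frac1{2\sigma^2}\sum_{a=1}^n(y_a-f_\theta(x_a))^2\}$. Let $\hat K=\Psi\Psi^\top\in\mathbb R^{n\times n}$, where $\Psi$ has the rows $\frac{\sigma_w}{\sqrt{d^L}}h^L(x_a)^\top$.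 Assume that there is $K\in\mathbb R^{n\times n}$ such that, under the prior, $\hat K\to K$ in probability and $\mathbb E[\hat K]\to K$ as $d_{\min}\to\infty$. Put $K_{\sigma^2}=\sigma^2I_n+K$ and $\|v\|_A^2=v^\top Av$. Then $$\mathrm{KL}\big(\mathcal N(0,I_d)\,\|\,P_{\theta\mid\mathcal D}\big)\;\to\; c:=\tfrac12\Big[\sigma^{-2}\,\mathrm{Tr}(K)+\|y\|^2_{\sigma^{-2}I_n-K_{\sigma^2}^{-1}}-\log\det\big(\sigma^{-2}K_{\sigma^2}\big)\Big]$$ as $d_{\min}\to\infty$. The limit $c$ is finite and non-negative, and it is nonzero if $K\neq 0$. Moreover, $c$ is equal to the KL divergence $\mathrm{KL}(P\,\|\,P_{\mathcal D})$ between the NNGP prior $P$ and posterior $P_{\mathcal D}$ in function space. Here $P$ is the law, on $\mathbb R^{\mathcal X}$ with the product $\sigma$-algebra, of a centred Gaussian process whose covariance function $k$ satisfies $k(x_a,x_b)=K_{ab}$ for all $a,b$, and $P_{\mathcal D}$ is the probability measure whose density with respect to $P$ is proportional to $\exp\{-\frac1{2\sigma^2}\sum_{a=1}^n(y_a-f(x_a))^2\}$.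 -/

import Mathlib

open MeasureTheory ProbabilityTheory Filter Topology

noncomputable section

/-- A real-valued feed-forward network on the input space `𝒳` with `H + 1` hidden layers (that is,
at least one) and a linear readout.  Hidden layer `ℓ` has `width ℓ` units and its own
`numParams ℓ` real parameters `θ ℓ`.  Its output may depend on `θ ℓ`, on the network input and
on the outputs of all the preceding hidden layers, so that fully connected, convolutional and
attention layers and skip connections are all allowed; only measurability is required. -/
structure BNN (𝒳 : Type*) (H : ℕ) where
  /-- The number of units of each hidden layer. -/
  width : Fin (H + 1) → ℕ
  /-- The number of parameters of each hidden layer. -/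
  numParams : Fin (H + 1) → ℕ
  /-- The map computed by a hidden layer: network input, parameters of the layer, outputs of the
  preceding hidden layers. -/
  layer : (ℓ : Fin (H + 1)) → 𝒳 → (Fin (numParams ℓ) → ℝ) →
    ((j : Set.Iio ℓ) → Fin (width j) → ℝ) → Fin (width ℓ) → ℝ
  measurable_layer : ∀ (ℓ : Fin (H + 1)) (x : 𝒳),
    Measurable fun q : (Fin (numParams ℓ) → ℝ) × ((j : Set.Iio ℓ) → Fin (width j) → ℝ) ↦
      layer ℓ x q.1 q.2
  /-- The scale of the readout weights. -/
  readoutScale : ℝ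

namespace BNN

variable {𝒳 : Type*} {H n : ℕ} (N : BNN 𝒳 H)

/-- The minimum hidden layer width. -/
def minWidth : ℕ := ⨅ ℓ, N.width ℓ

/-- The width of the last hidden layer, which is also the number of readout weights. -/
abbrev lastWidth : ℕ := N.width (Fin.last H)

/-- The index set of the flattened parameter vector: the parameters of all the hidden layers,
followed by the readout weights. -/
abbrev ParamIdx : Type := (Σ ℓ : Fin (H + 1), Fin (N.numParams ℓ)) ⊕ Fin N.lastWidth

/-- The parameter space `ℝ ^ d`. -/
abbrev Params : Type := N.ParamIdx → ℝ

/-- The outputs of the hidden layers on the input `x`. -/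
def hidden {𝒳 : Type*} {H : ℕ} (N : BNN 𝒳 H) (θ : N.Params) (x : 𝒳) (ℓ : Fin (H + 1)) :
    Fin (N.width ℓ) → ℝ :=
  N.layer ℓ x (fun c ↦ θ (Sum.inl ⟨ℓ, c⟩)) (fun j ↦ N.hidden θ x j.1)
termination_by ℓ
decreasing_by exact j.2

/-- The scaled embedding of the input `x` given by the last hidden layer. -/
def embedding (θ : N.Params) (x : 𝒳) : Fin N.lastWidth → ℝ := fun j ↦
  N.readoutScale / Real.sqrt N.lastWidth * N.hidden θ x (Fin.last H) j

/-- The function computed by the network with parameters `θ`: the readout is linear. -/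
def output (θ : N.Params) (x : 𝒳) : ℝ := ∑ j, N.embedding θ x j * θ (Sum.inr j)

/-- The `n × lastWidth` matrix `Ψ` of scaled embeddings of the training inputs. -/
def embeddingMatrix (θ : N.Params) (X : Fin n → 𝒳) : Matrix (Fin n) (Fin N.lastWidth) ℝ :=
  Matrix.of fun a ↦ N.embedding θ (X a)

/-- The empirical kernel matrix `Ψ Ψᵀ` on the training inputs. -/
def empiricalKernel (θ : N.Params) (X : Fin n → 𝒳) : Matrix (Fin n) (Fin n) ℝ :=
  N.embeddingMatrix θ X * (N.embeddingMatrix θ X).transpose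

/-- The prior `N(0, I_d)` on the parameters. -/
def prior : Measure N.Params := Measure.pi fun _ ↦ gaussianReal 0 1

end BNN

/-- The Bayesian posterior of a random function `F : Ω → (𝒳 → ℝ)` with prior `P` on `Ω`, given
the data `(X, y)` and the Gaussian likelihood with variance `σ ^ 2`: the probability measure
whose density with respect to `P` is proportional to
`exp (-(∑ a, (y a - F ω (X a)) ^ 2) / (2 * σ ^ 2))`. -/
def gaussianPosterior {Ω 𝒳 : Type*} [MeasurableSpace Ω] {n : ℕ} (P : Measure Ω) (F : Ω → 𝒳 → ℝ)
    (σ : ℝ) (X : Fin n → 𝒳) (y : Fin n → ℝ) : Measure Ω :=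
  P.tilted fun ω ↦ -(∑ a, (y a - F ω (X a)) ^ 2) / (2 * σ ^ 2)

/-- The posterior of the network parameters, under the prior `N(0, I_d)`. -/
def BNN.posterior {𝒳 : Type*} {H n : ℕ} (N : BNN 𝒳 H) (σ : ℝ) (X : Fin n → 𝒳) (y : Fin n → ℝ) :
    Measure N.Params :=
  gaussianPosterior N.prior N.output σ X y

/-- `P` is the law, on `𝒳 → ℝ` with the product σ-algebra, of the centred Gaussian process with
covariance function `k`. -/
structure IsCenteredGaussianProcessLaw {𝒳 : Type*} (k : 𝒳 → 𝒳 → ℝ) (P : Measure (𝒳 → ℝ)) :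
    Prop where
  isGaussianProcess : IsGaussianProcess (fun (x : 𝒳) (f : 𝒳 → ℝ) ↦ f x) P
  mean_eq_zero : ∀ x, ∫ f, f x ∂P = 0
  covariance_eq : ∀ x x', cov[fun f : 𝒳 → ℝ ↦ f x, fun f : 𝒳 → ℝ ↦ f x'; P] = k x x'

/-- With `K_{σ²} = σ² I + K`, the number
`(σ⁻² Tr K + yᵀ (σ⁻² I - K_{σ²}⁻¹) y - log det (σ⁻² K_{σ²})) / 2`. -/
def limitKL {n : ℕ} (σ : ℝ) (K : Matrix (Fin n) (Fin n) ℝ) (y : Fin n → ℝ) : ℝ :=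
  let Kσ : Matrix (Fin n) (Fin n) ℝ := σ ^ 2 • (1 : Matrix (Fin n) (Fin n) ℝ) + K
  1 / 2 * ((σ ^ 2)⁻¹ * K.trace
    + dotProduct y
        (Matrix.mulVec ((σ ^ 2)⁻¹ • (1 : Matrix (Fin n) (Fin n) ℝ) - Kσ⁻¹) y)
    - Real.log ((σ ^ 2)⁻¹ • Kσ).det)

end

/-!
Tilting a probability measure `P` by a non-positive integrable function `g` gives
`KL(P ‖ P.tilted g) = -E[g] + log E[exp g]`. For the Gaussian log-likelihood `g` of a centred
square-integrable function `f` this is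
`(‖y‖² + ∑ a, E[f(x_a)²]) / (2 σ²) + log Z`, with the evidence `Z = E[exp g]`
(`klDiv_gaussianPosterior`).

If `f` is Gaussian on the inputs with covariance `S`, then `Z` is a closed-form function
`gaussianEvidence σ y S`: in an eigenbasis of `S` the coordinates of `f` are independent and the
integral splits into one-dimensional ones (`integral_exp_neg_sq_of_hasGaussianLaw`). Substituting
this yields `limitKL`, which settles the Gaussian process. In the same eigenbasis `limitKL` is a sum
of terms `t - log (1 + t)` with `t ≥ 0` and of non-negative multiples of squares, so it is
non-negative, and positive if `S ≠ 0`.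

The hidden layers do not depend on the readout weights. Given the hidden parameters, the output of
the network is therefore a centred Gaussian vector with covariance the empirical kernel `K̂`, and
integrating out the readout weights turns the second moments into `E[Tr K̂]` and the evidence into
`E[gaussianEvidence σ y K̂]` (`BNN.klDiv_prior_posterior`). The first converges by assumption. On
positive semidefinite matrices `gaussianEvidence σ y` is continuous, with values in `(0, 1]`, so
convergence of `K̂` in probability suffices for the second
(`tendsto_integral_comp_of_tendsto_measure`). The limit `K` is positive semidefinite because the
matrices `E[K̂]` are.
-/

/-! ### The Gaussian evidence of a covariance matrix -/

open Matrix in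
/-- The Gaussian evidence: the integral of `exp (-‖y - f‖² / (2 σ²))` over `f ∼ N(0, S)`, in closed
form.  It is a function of all matrices, with this meaning where `S` is positive semidefinite. -/
noncomputable def gaussianEvidence {n : ℕ} (σ : ℝ) (y : Fin n → ℝ) (S : Matrix (Fin n) (Fin n) ℝ) :
    ℝ :=
  Real.exp (-(y ⬝ᵥ ((σ ^ 2 • (1 : Matrix (Fin n) (Fin n) ℝ) + S)⁻¹ *ᵥ y)) / 2) /
    Real.sqrt ((σ ^ 2)⁻¹ • (σ ^ 2 • (1 : Matrix (Fin n) (Fin n) ℝ) + S)).det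

/-- A spectral decomposition `S = U diag(l) Uᵀ` with `U` orthogonal and `l ≥ 0`. -/
structure IsSpectralDecomp {n : ℕ} (S U : Matrix (Fin n) (Fin n) ℝ) (l : Fin n → ℝ) : Prop where
  mul_transpose : U * U.transpose = 1
  nonneg : ∀ i, 0 ≤ l i
  eq : S = U * Matrix.diagonal l * U.transpose

namespace IsSpectralDecomp

open Matrix

variable {n : ℕ} {S U : Matrix (Fin n) (Fin n) ℝ} {l : Fin n → ℝ} {σ : ℝ}

theorem _root_.Matrix.PosSemidef.exists_isSpectralDecomp (hS : S.PosSemidef) :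
    ∃ U l, IsSpectralDecomp S U l := by
  refine ⟨hS.1.eigenvectorUnitary, hS.1.eigenvalues, ?_, hS.eigenvalues_nonneg, ?_⟩
  · have := (Matrix.mem_unitaryGroup_iff).1 hS.1.eigenvectorUnitary.2
    simpa [star_eq_conjTranspose, conjTranspose_eq_transpose_of_trivial] using this
  · conv_lhs => rw [hS.1.spectral_theorem]
    simp [Unitary.conjStarAlgAut_apply, star_eq_conjTranspose,
      conjTranspose_eq_transpose_of_trivial]

theorem transpose_mul (h : IsSpectralDecomp S U l) : Uᵀ * U = 1 :=
  mul_eq_one_comm.1 h.mul_transpose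

theorem dotProduct_transpose_mulVec (h : IsSpectralDecomp S U l) (v w : Fin n → ℝ) :
    (Uᵀ *ᵥ v) ⬝ᵥ (Uᵀ *ᵥ w) = v ⬝ᵥ w := by
  rw [dotProduct_mulVec, vecMul_transpose, mulVec_mulVec, h.mul_transpose, one_mulVec]

theorem smul_one_add (h : IsSpectralDecomp S U l) (c : ℝ) :
    c • (1 : Matrix (Fin n) (Fin n) ℝ) + S = U * diagonal (fun i ↦ c + l i) * Uᵀ := by
  have : diagonal (fun i ↦ c + l i) = c • (1 : Matrix (Fin n) (Fin n) ℝ) + diagonal l := by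
    rw [smul_one_eq_diagonal, diagonal_add]
  rw [this, mul_add, add_mul, ← h.eq]
  simp [h.mul_transpose]

theorem inv_smul_one_add (h : IsSpectralDecomp S U l) {c : ℝ} (hc : 0 < c) :
    (c • (1 : Matrix (Fin n) (Fin n) ℝ) + S)⁻¹ = U * diagonal (fun i ↦ (c + l i)⁻¹) * Uᵀ := by
  refine inv_eq_right_inv ?_
  have hd : diagonal (fun i ↦ c + l i) * diagonal (fun i ↦ (c + l i)⁻¹) = 1 := by
    rw [diagonal_mul_diagonal, ← diagonal_one]
    congr 1
    ext i
    exact mul_inv_cancel₀ (add_pos_of_pos_of_nonneg hc (h.nonneg i)).ne'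
  calc (c • (1 : Matrix (Fin n) (Fin n) ℝ) + S) * (U * diagonal (fun i ↦ (c + l i)⁻¹) * Uᵀ)
      = U * (diagonal (fun i ↦ c + l i) * (Uᵀ * U) * diagonal (fun i ↦ (c + l i)⁻¹)) * Uᵀ := by
        rw [h.smul_one_add]; simp only [Matrix.mul_assoc]
    _ = 1 := by rw [h.transpose_mul, Matrix.mul_one, hd, Matrix.mul_one, h.mul_transpose]

theorem dotProduct_mulVec_conj (d v : Fin n → ℝ) :
    v ⬝ᵥ ((U * diagonal d * Uᵀ) *ᵥ v) = ∑ i, d i * (Uᵀ *ᵥ v) i ^ 2 := by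
  rw [← mulVec_mulVec, ← mulVec_mulVec, dotProduct_mulVec, ← mulVec_transpose, dotProduct]
  refine Finset.sum_congr rfl fun i _ ↦ ?_
  rw [mulVec_diagonal]; ring

theorem dotProduct_inv_mulVec (h : IsSpectralDecomp S U l) {c : ℝ} (hc : 0 < c) (v : Fin n → ℝ) :
    v ⬝ᵥ ((c • (1 : Matrix (Fin n) (Fin n) ℝ) + S)⁻¹ *ᵥ v)
      = ∑ i, (c + l i)⁻¹ * (Uᵀ *ᵥ v) i ^ 2 := by
  rw [h.inv_smul_one_add hc, dotProduct_mulVec_conj]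

theorem det_conj (h : IsSpectralDecomp S U l) (d : Fin n → ℝ) :
    (U * diagonal d * Uᵀ).det = ∏ i, d i := by
  rw [det_mul_right_comm, h.mul_transpose, one_mul, det_diagonal]

theorem det_inv_smul (h : IsSpectralDecomp S U l) (hσ : 0 < σ) :
    ((σ ^ 2)⁻¹ • (σ ^ 2 • (1 : Matrix (Fin n) (Fin n) ℝ) + S)).det = ∏ i, (1 + l i / σ ^ 2) := by
  rw [det_smul, h.smul_one_add, h.det_conj, Fintype.card_fin, ← Fin.prod_const,
    ← Finset.prod_mul_distrib]
  refine Finset.prod_congr rfl fun i _ ↦ ?_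
  field_simp

theorem trace_eq (h : IsSpectralDecomp S U l) : S.trace = ∑ i, l i := by
  rw [h.eq, trace_mul_comm, ← Matrix.mul_assoc, h.transpose_mul, Matrix.one_mul, trace_diagonal]

theorem gaussianEvidence_eq_prod (h : IsSpectralDecomp S U l) (hσ : 0 < σ) (y : Fin n → ℝ) :
    gaussianEvidence σ y S =
      ∏ i, Real.exp (-(Uᵀ *ᵥ y) i ^ 2 / (2 * (σ ^ 2 + l i))) / Real.sqrt (1 + l i / σ ^ 2) := by
  have hl := h.nonneg
  rw [gaussianEvidence, h.dotProduct_inv_mulVec (by positivity), h.det_inv_smul hσ,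
    Finset.prod_div_distrib, ← Real.exp_sum,
    Real.sqrt_prod _ fun i _ ↦ by have := hl i; positivity]
  congr 2
  rw [neg_div, Finset.sum_div, ← Finset.sum_neg_distrib]
  refine Finset.sum_congr rfl fun i _ ↦ ?_
  have : σ ^ 2 + l i ≠ 0 := by have := hl i; positivity
  field_simp

/-- `limitKL` as a sum over the eigenvalues; each summand is non-negative. -/
theorem limitKL_eq_sum (h : IsSpectralDecomp S U l) (hσ : 0 < σ) (y : Fin n → ℝ) :
    limitKL σ S y = ∑ i, 1 / 2 * ((l i / σ ^ 2 - Real.log (1 + l i / σ ^ 2)) +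
      ((σ ^ 2)⁻¹ - (σ ^ 2 + l i)⁻¹) * (Uᵀ *ᵥ y) i ^ 2) := by
  have hl := h.nonneg
  have hn : y ⬝ᵥ y = ∑ i, (Uᵀ *ᵥ y) i ^ 2 := by
    rw [← h.dotProduct_transpose_mulVec y y]; simp [dotProduct, pow_two]
  simp only [limitKL, sub_mulVec, smul_mulVec, one_mulVec, dotProduct_sub, dotProduct_smul,
    smul_eq_mul]
  rw [h.dotProduct_inv_mulVec (by positivity), h.det_inv_smul hσ, h.trace_eq, hn,
    Real.log_prod fun i _ ↦ by have := hl i; positivity]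
  simp only [Finset.mul_sum, ← Finset.sum_sub_distrib, ← Finset.sum_add_distrib]
  refine Finset.sum_congr rfl fun i _ ↦ ?_
  ring

end IsSpectralDecomp

section PosSemidef

open Matrix

variable {n : ℕ} {S : Matrix (Fin n) (Fin n) ℝ} {σ : ℝ}

theorem gaussianEvidence_pos (hS : S.PosSemidef) (hσ : 0 < σ) (y : Fin n → ℝ) :
    0 < gaussianEvidence σ y S := by
  obtain ⟨U, l, h⟩ := hS.exists_isSpectralDecomp
  have hl := h.nonneg
  rw [h.gaussianEvidence_eq_prod hσ]
  exact Finset.prod_pos fun i _ ↦ by have := hl i; positivity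

theorem gaussianEvidence_le_one (hS : S.PosSemidef) (hσ : 0 < σ) (y : Fin n → ℝ) :
    gaussianEvidence σ y S ≤ 1 := by
  obtain ⟨U, l, h⟩ := hS.exists_isSpectralDecomp
  have hl := h.nonneg
  rw [h.gaussianEvidence_eq_prod hσ]
  refine Finset.prod_le_one (fun i _ ↦ by positivity) fun i _ ↦ div_le_one_of_le₀ ?_ (by positivity)
  have := hl i
  calc Real.exp _ ≤ 1 := by
        rw [Real.exp_le_one_iff, neg_div]
        exact neg_nonpos.2 (by positivity)
    _ ≤ _ := Real.one_le_sqrt.2 (by have : 0 ≤ l i / σ ^ 2 := by positivity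
                                    linarith)

theorem continuousAt_gaussianEvidence (hS : S.PosSemidef) (hσ : 0 < σ) (y : Fin n → ℝ) :
    ContinuousAt (gaussianEvidence σ y) S := by
  obtain ⟨U, l, h⟩ := hS.exists_isSpectralDecomp
  have hl := h.nonneg
  have hd : (σ ^ 2 • (1 : Matrix (Fin n) (Fin n) ℝ) + S).det ≠ 0 := by
    rw [h.smul_one_add, h.det_conj]
    exact Finset.prod_ne_zero_iff.2 fun i _ ↦ by have := hl i; positivity
  have hd' : Real.sqrt ((σ ^ 2)⁻¹ • (σ ^ 2 • (1 : Matrix (Fin n) (Fin n) ℝ) + S)).det ≠ 0 := by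
    rw [h.det_inv_smul hσ]
    exact (Real.sqrt_pos.2 (Finset.prod_pos fun i _ ↦ by have := hl i; positivity)).ne'
  have hadd : ContinuousAt (fun M : Matrix (Fin n) (Fin n) ℝ ↦
      σ ^ 2 • (1 : Matrix (Fin n) (Fin n) ℝ) + M) S := by fun_prop
  have hinv : ContinuousAt (fun M : Matrix (Fin n) (Fin n) ℝ ↦
      (σ ^ 2 • (1 : Matrix (Fin n) (Fin n) ℝ) + M)⁻¹) S := by
    refine ContinuousAt.comp (g := fun M : Matrix (Fin n) (Fin n) ℝ ↦ M⁻¹) ?_ hadd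
    refine continuousAt_matrix_inv _ ?_
    rw [Ring.inverse_eq_inv']
    exact continuousAt_inv₀ hd
  unfold gaussianEvidence
  refine ContinuousAt.div ?_ ?_ hd'
  · refine Real.continuous_exp.continuousAt.comp ?_
    refine (ContinuousAt.neg ?_).div_const _
    exact ContinuousAt.comp (g := fun M : Matrix (Fin n) (Fin n) ℝ ↦ y ⬝ᵥ (M *ᵥ y))
      (by fun_prop) hinv
  · exact Continuous.continuousAt (by fun_prop)

/-- `limitKL` is the expected loss plus the logarithm of the evidence. -/
theorem limitKL_eq_add_log_gaussianEvidence (hS : S.PosSemidef) (hσ : 0 < σ) (y : Fin n → ℝ) :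
    limitKL σ S y =
      (∑ a, y a ^ 2 + ∑ a, S a a) / (2 * σ ^ 2) + Real.log (gaussianEvidence σ y S) := by
  obtain ⟨U, l, h⟩ := hS.exists_isSpectralDecomp
  have hl := h.nonneg
  have hdet : 0 < ((σ ^ 2)⁻¹ • (σ ^ 2 • (1 : Matrix (Fin n) (Fin n) ℝ) + S)).det := by
    rw [h.det_inv_smul hσ]
    exact Finset.prod_pos fun i _ ↦ by have := hl i; positivity
  rw [gaussianEvidence, Real.log_div (Real.exp_ne_zero _) (Real.sqrt_pos.2 hdet).ne', Real.log_exp,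
    Real.log_sqrt hdet.le]
  simp only [limitKL, sub_mulVec, smul_mulVec, one_mulVec, dotProduct_sub, dotProduct_smul,
    smul_eq_mul]
  have hn : y ⬝ᵥ y = ∑ a, y a ^ 2 := by simp [dotProduct, pow_two]
  have ht : S.trace = ∑ a, S a a := rfl
  rw [hn, ht]
  field_simp
  ring

theorem limitKL_nonneg (hS : S.PosSemidef) (hσ : 0 < σ) (y : Fin n → ℝ) : 0 ≤ limitKL σ S y := by
  obtain ⟨U, l, h⟩ := hS.exists_isSpectralDecomp
  have hl := h.nonneg
  rw [h.limitKL_eq_sum hσ]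
  refine Finset.sum_nonneg fun i _ ↦ ?_
  have h0 : 0 ≤ l i / σ ^ 2 := by have := hl i; positivity
  have h1 := Real.log_le_sub_one_of_pos (x := 1 + l i / σ ^ 2) (by positivity)
  have h2 : (σ ^ 2 + l i)⁻¹ ≤ (σ ^ 2)⁻¹ := inv_anti₀ (by positivity) (by linarith [hl i])
  have h3 := mul_nonneg (sub_nonneg.2 h2) (sq_nonneg ((Uᵀ *ᵥ y) i))
  linarith

theorem limitKL_pos (hS : S.PosSemidef) (hS0 : S ≠ 0) (hσ : 0 < σ) (y : Fin n → ℝ) :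
    0 < limitKL σ S y := by
  obtain ⟨U, l, h⟩ := hS.exists_isSpectralDecomp
  have hl := h.nonneg
  have hex : ∃ i, l i ≠ 0 := by
    by_contra! hall
    refine hS0 ?_
    rw [h.eq, show l = 0 from funext hall]
    simp
  obtain ⟨j, hj⟩ := hex
  rw [h.limitKL_eq_sum hσ]
  have h3 : ∀ i, 0 ≤ ((σ ^ 2)⁻¹ - (σ ^ 2 + l i)⁻¹) * (Uᵀ *ᵥ y) i ^ 2 := fun i ↦
    mul_nonneg (sub_nonneg.2 (inv_anti₀ (by positivity) (by linarith [hl i]))) (sq_nonneg _)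
  refine Finset.sum_pos' (fun i _ ↦ ?_) ⟨j, Finset.mem_univ j, ?_⟩
  · have h0 : 0 ≤ l i / σ ^ 2 := by have := hl i; positivity
    have h1 := Real.log_le_sub_one_of_pos (x := 1 + l i / σ ^ 2) (by positivity)
    linarith [h3 i]
  · have hlj : 0 < l j := lt_of_le_of_ne (hl j) hj.symm
    have h0 : 0 < l j / σ ^ 2 := by positivity
    have h1 := Real.log_lt_sub_one_of_pos (x := 1 + l j / σ ^ 2) (by positivity) (by linarith)
    linarith [h3 j]

end PosSemidef

/-! ### Gaussian integrals of the likelihood -/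

theorem integral_exp_neg_sq_gaussianReal {σ : ℝ} (hσ : 0 < σ) (y : ℝ) (v : NNReal) :
    ∫ x, Real.exp (-(y - x) ^ 2 / (2 * σ ^ 2)) ∂gaussianReal 0 v =
      Real.exp (-y ^ 2 / (2 * (σ ^ 2 + v))) / Real.sqrt (1 + v / σ ^ 2) := by
  rcases eq_or_ne v 0 with rfl | hv
  · simp [gaussianReal_zero_var]
  have hv' : (0 : ℝ) < v := by positivity
  -- complete the square
  have hsq : ∀ x : ℝ, gaussianPDFReal 0 v x • Real.exp (-(y - x) ^ 2 / (2 * σ ^ 2)) =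
      ((Real.sqrt (2 * Real.pi * v))⁻¹ * Real.exp (-y ^ 2 / (2 * (σ ^ 2 + v)))) *
        Real.exp (-((σ ^ 2 + v) / (2 * σ ^ 2 * v)) * (x - y * v / (σ ^ 2 + v)) ^ 2) := by
    intro x
    rw [gaussianPDFReal, smul_eq_mul, mul_assoc _⁻¹, mul_assoc _⁻¹, ← Real.exp_add, ← Real.exp_add]
    congr 2
    field_simp
    ring
  rw [integral_gaussianReal_eq_integral_smul hv]
  simp_rw [hsq]
  rw [integral_const_mul, integral_sub_right_eq_self
    (fun x ↦ Real.exp (-((σ ^ 2 + v) / (2 * σ ^ 2 * v)) * x ^ 2)), integral_gaussian,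
    mul_comm _⁻¹, mul_assoc, div_eq_mul_inv (Real.exp _), ← Real.sqrt_inv, ← Real.sqrt_inv,
    ← Real.sqrt_mul (by positivity)]
  congr 2
  field_simp

open Matrix in
/-- The integral of the Gaussian likelihood over a centred Gaussian vector with covariance `S` is
`gaussianEvidence σ y S`.  In an orthonormal eigenbasis of `S` the coordinates of the vector are
independent, and the integral is a product of one-dimensional ones. -/
theorem integral_exp_neg_sq_of_hasGaussianLaw {Ω : Type*} [MeasurableSpace Ω] {P : Measure Ω}
    {n : ℕ} {F : Fin n → Ω → ℝ} {S : Matrix (Fin n) (Fin n) ℝ} {σ : ℝ}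
    (hF : HasGaussianLaw (fun ω a ↦ F a ω) P) (hmean : ∀ a, ∫ ω, F a ω ∂P = 0)
    (hcov : ∀ a b, cov[F a, F b; P] = S a b) (hS : S.PosSemidef) (hσ : 0 < σ) (y : Fin n → ℝ) :
    ∫ ω, Real.exp (-(∑ a, (y a - F a ω) ^ 2) / (2 * σ ^ 2)) ∂P = gaussianEvidence σ y S := by
  have := hF.isProbabilityMeasure
  obtain ⟨U, l, h⟩ := hS.exists_isSpectralDecomp
  set G : Fin n → Ω → ℝ := fun i ω ↦ (Uᵀ *ᵥ fun a ↦ F a ω) i with hG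
  have hG' : ∀ i ω, G i ω = ∑ a, U a i * F a ω := fun i ω ↦ rfl
  have hF2 : ∀ a, MemLp (F a) 2 P := fun a ↦ (hF.eval a).memLp_two
  have hGlaw : HasGaussianLaw (fun ω i ↦ G i ω) P :=
    hF.map_fun (Matrix.mulVecLin Uᵀ).toContinuousLinearMap
  have hGmean : ∀ i, ∫ ω, G i ω ∂P = 0 := by
    intro i
    simp_rw [hG']
    rw [integral_finsetSum _ fun a _ ↦ ((hF2 a).integrable (by norm_num)).const_mul _]
    simp [integral_const_mul, hmean]
  have hGcov : ∀ i j, cov[G i, G j; P] = diagonal l i j := by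
    intro i j
    have hUSU : Uᵀ * S * U = diagonal l := by
      calc Uᵀ * S * U = (Uᵀ * U) * diagonal l * (Uᵀ * U) := by
            rw [h.eq]; simp only [Matrix.mul_assoc]
        _ = diagonal l := by rw [h.transpose_mul, Matrix.one_mul, Matrix.mul_one]
    have hc := covariance_fun_sum_fun_sum (μ := P) (X := fun a ω ↦ U a i * F a ω)
      (Y := fun a ω ↦ U a j * F a ω)
      (fun a ↦ (hF2 a).const_mul _) (fun a ↦ (hF2 a).const_mul _)
    refine hc.trans ?_
    simp_rw [covariance_const_mul_left, covariance_const_mul_right, hcov]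
    rw [← hUSU, Matrix.mul_apply, Finset.sum_comm]
    refine Finset.sum_congr rfl fun b _ ↦ ?_
    rw [Matrix.mul_apply, Finset.sum_mul]
    refine Finset.sum_congr rfl fun a _ ↦ ?_
    rw [transpose_apply]; ring
  have hind : iIndepFun G P := hGlaw.iIndepFun_of_covariance_eq_zero fun i j hij ↦ by
    rw [hGcov, diagonal_apply_ne _ hij]
  have hmap : ∀ i, P.map (G i) = gaussianReal 0 (l i).toNNReal := fun i ↦ by
    rw [(hGlaw.eval i).map_eq_gaussianReal, hGmean,
      ← covariance_self (hGlaw.eval i).aemeasurable, hGcov, diagonal_apply_eq]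
  have hrot : ∀ ω, Real.exp (-(∑ a, (y a - F a ω) ^ 2) / (2 * σ ^ 2)) =
      ∏ i, Real.exp (-((Uᵀ *ᵥ y) i - G i ω) ^ 2 / (2 * σ ^ 2)) := by
    intro ω
    rw [← Real.exp_sum, ← Finset.sum_div, Finset.sum_neg_distrib]
    have := h.dotProduct_transpose_mulVec (y - fun a ↦ F a ω) (y - fun a ↦ F a ω)
    rw [mulVec_sub] at this
    simp only [dotProduct, Pi.sub_apply, ← pow_two] at this
    rw [← this]
  simp_rw [hrot]
  rw [hind.integral_fun_prod_comp (fun i ↦ (hGlaw.eval i).aemeasurable)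
    (f := fun i x ↦ Real.exp (-((Uᵀ *ᵥ y) i - x) ^ 2 / (2 * σ ^ 2)))
    (fun i ↦ Continuous.aestronglyMeasurable (by fun_prop)),
    h.gaussianEvidence_eq_prod hσ]
  refine Finset.prod_congr rfl fun i _ ↦ ?_
  rw [← integral_map (f := fun x ↦ Real.exp (-((Uᵀ *ᵥ y) i - x) ^ 2 / (2 * σ ^ 2)))
    (hGlaw.eval i).aemeasurable (Continuous.aestronglyMeasurable (by fun_prop)), hmap,
    integral_exp_neg_sq_gaussianReal hσ, Real.coe_toNNReal _ (h.nonneg i)]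

/-! ### The divergence of the posterior from the prior -/

section Posterior

variable {Ω 𝒳 : Type*} [MeasurableSpace Ω] {P : Measure Ω} {F : Ω → 𝒳 → ℝ} {n : ℕ}
  {X : Fin n → 𝒳}

/-- Non-positivity of `g` makes `exp g` integrable, and integrability of `g` is that of the
log-likelihood ratio, so that the divergence is not `∞`. -/
theorem klDiv_tilted_of_nonpos [IsProbabilityMeasure P] {g : Ω → ℝ} (hg : Integrable g P)
    (hg0 : ∀ ω, g ω ≤ 0) :
    InformationTheory.klDiv P (P.tilted g) =
      ENNReal.ofReal (-∫ ω, g ω ∂P + Real.log (∫ ω, Real.exp (g ω) ∂P)) := by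
  have hexp : Integrable (fun ω ↦ Real.exp (g ω)) P := by
    refine (integrable_const (1 : ℝ)).mono'
      (Real.continuous_exp.comp_aestronglyMeasurable hg.aestronglyMeasurable)
      (ae_of_all _ fun ω ↦ ?_)
    rw [Real.norm_eq_abs, Real.abs_exp]
    exact Real.exp_le_one_iff.2 (hg0 ω)
  have hllr : llr P P =ᵐ[P] 0 := llr_self P
  have hllr_int : Integrable (llr P P) P := (integrable_zero _ _ _).congr hllr.symm
  have := isProbabilityMeasure_tilted hexp
  rw [InformationTheory.klDiv_of_ac_of_integrable (absolutelyContinuous_tilted hexp)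
      (integrable_llr_tilted_right .rfl hg hllr_int hexp),
    integral_llr_tilted_right .rfl hg hexp hllr_int, integral_congr_ae hllr]
  simp

/-- The cross terms `y a * F ω (X a)` of the expected loss vanish as `F` is centred. -/
theorem klDiv_gaussianPosterior [IsProbabilityMeasure P]
    (hF : ∀ a, MemLp (fun ω ↦ F ω (X a)) 2 P) (hmean : ∀ a, ∫ ω, F ω (X a) ∂P = 0)
    (σ : ℝ) (y : Fin n → ℝ) :
    InformationTheory.klDiv P (gaussianPosterior P F σ X y) =
      ENNReal.ofReal ((∑ a, y a ^ 2 + ∑ a, ∫ ω, F ω (X a) ^ 2 ∂P) / (2 * σ ^ 2) +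
        Real.log (∫ ω, Real.exp (-(∑ a, (y a - F ω (X a)) ^ 2) / (2 * σ ^ 2)) ∂P)) := by
  have hint1 : ∀ a, Integrable (fun ω ↦ F ω (X a)) P := fun a ↦ (hF a).integrable (by norm_num)
  have hint2 : ∀ a, Integrable (fun ω ↦ F ω (X a) ^ 2) P := fun a ↦ (hF a).integrable_sq
  have hexpand : ∀ a ω, (y a - F ω (X a)) ^ 2 = y a ^ 2 - 2 * y a * F ω (X a) + F ω (X a) ^ 2 :=
    fun a ω ↦ by ring
  have hlin : ∀ a, Integrable (fun ω ↦ y a ^ 2 - 2 * y a * F ω (X a)) P := fun a ↦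
    (integrable_const _).sub ((hint1 a).const_mul _)
  have hsq : ∀ a, Integrable (fun ω ↦ (y a - F ω (X a)) ^ 2) P := by
    intro a
    simp_rw [hexpand]
    exact (hlin a).add (hint2 a)
  have hval : ∀ a, ∫ ω, (y a - F ω (X a)) ^ 2 ∂P = y a ^ 2 + ∫ ω, F ω (X a) ^ 2 ∂P := by
    intro a
    simp_rw [hexpand]
    rw [integral_add (hlin a) (hint2 a),
      integral_sub (integrable_const _) ((hint1 a).const_mul _), integral_const_mul, hmean]
    simp
  have hg : Integrable (fun ω ↦ -(∑ a, (y a - F ω (X a)) ^ 2) / (2 * σ ^ 2)) P :=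
    (integrable_finsetSum _ fun a _ ↦ hsq a).neg.div_const _
  rw [gaussianPosterior, klDiv_tilted_of_nonpos hg fun ω ↦ by
    rw [neg_div]; exact neg_nonpos.2 (by positivity)]
  rw [integral_div, integral_neg, integral_finsetSum _ fun a _ ↦ hsq a]
  simp_rw [hval]
  rw [Finset.sum_add_distrib, neg_div, neg_neg]

/-- The divergence of the posterior from a Gaussian process prior is `limitKL`. -/
theorem klDiv_gaussianPosterior_of_hasGaussianLaw {S : Matrix (Fin n) (Fin n) ℝ} {σ : ℝ}
    (hF : HasGaussianLaw (fun ω a ↦ F ω (X a)) P) (hmean : ∀ a, ∫ ω, F ω (X a) ∂P = 0)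
    (hcov : ∀ a b, cov[fun ω ↦ F ω (X a), fun ω ↦ F ω (X b); P] = S a b)
    (hS : S.PosSemidef) (hσ : 0 < σ) (y : Fin n → ℝ) :
    InformationTheory.klDiv P (gaussianPosterior P F σ X y) =
      ENNReal.ofReal (limitKL σ S y) := by
  have := hF.isProbabilityMeasure
  have hF' : HasGaussianLaw (fun ω a ↦ (fun a ω ↦ F ω (X a)) a ω) P := hF
  have h2 : ∀ a, MemLp (fun ω ↦ F ω (X a)) 2 P := fun a ↦ (hF'.eval a).memLp_two
  rw [klDiv_gaussianPosterior h2 hmean,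
    integral_exp_neg_sq_of_hasGaussianLaw hF' hmean hcov hS hσ,
    limitKL_eq_add_log_gaussianEvidence hS hσ]
  congr 5
  ext a
  rw [← hcov, covariance_eq_sub (h2 a) (h2 a), hmean]
  simp [pow_two]

end Posterior

/-! ### Bounded functions of variables converging in probability -/

/-- A function with values in `[0, 1]`, continuous at `K`, has expectations converging to its value
at `K` along random matrices converging to `K` in probability.  The matrices may live on different
probability spaces. -/
theorem tendsto_integral_comp_of_tendsto_measure {ι : Type*} {n : ℕ} {f : Filter ι}
    {Ω : ι → Type*} [∀ i, MeasurableSpace (Ω i)] (P : ∀ i, Measure (Ω i))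
    [∀ i, IsProbabilityMeasure (P i)] {M : ∀ i, Ω i → Matrix (Fin n) (Fin n) ℝ}
    {K : Matrix (Fin n) (Fin n) ℝ} {G : Matrix (Fin n) (Fin n) ℝ → ℝ}
    (hM : ∀ i a b, Measurable fun ω ↦ M i ω a b)
    (hGM : ∀ i, AEStronglyMeasurable (fun ω ↦ G (M i ω)) (P i))
    (hG : ∀ i ω, G (M i ω) ∈ Set.Icc 0 1) (hGK : G K ∈ Set.Icc (0 : ℝ) 1) (hcont : ContinuousAt G K)
    (hprob : ∀ a b, ∀ ε : ℝ, 0 < ε →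
      Tendsto (fun i ↦ P i {ω | ε ≤ |M i ω a b - K a b|}) f (𝓝 0)) :
    Tendsto (fun i ↦ ∫ ω, G (M i ω) ∂P i) f (𝓝 (G K)) := by
  rw [Metric.tendsto_nhds]
  intro ε hε
  obtain ⟨δ, hδ, hball⟩ := (Metric.continuousAt_iff (α := Fin n → Fin n → ℝ) (f := G)).1 hcont
    (ε / 2) (half_pos hε)
  -- the event that some entry of `M i` is not `δ`-close to that of `K`
  let B : ∀ i, Set (Ω i) := fun i ↦ ⋃ a, ⋃ b, {ω | δ ≤ |M i ω a b - K a b|}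
  have hBmeas : ∀ i, MeasurableSet (B i) := fun i ↦
    MeasurableSet.iUnion fun a ↦ MeasurableSet.iUnion fun b ↦
      measurableSet_le measurable_const ((hM i a b).sub_const _).abs
  have hB : Tendsto (fun i ↦ P i (B i)) f (𝓝 0) := by
    have hsum : Tendsto (fun i ↦ ∑ a, ∑ b, P i {ω | δ ≤ |M i ω a b - K a b|}) f (𝓝 0) := by
      simpa using tendsto_finsetSum Finset.univ fun a _ ↦
        tendsto_finsetSum Finset.univ fun b _ ↦ hprob a b δ hδ
    refine tendsto_of_tendsto_of_tendsto_of_le_of_le tendsto_const_nhds hsum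
      (fun i ↦ zero_le) fun i ↦ ?_
    refine (measure_iUnion_fintype_le _ _).trans (Finset.sum_le_sum fun a _ ↦ ?_)
    exact measure_iUnion_fintype_le _ _
  have hBreal : Tendsto (fun i ↦ (P i).real (B i)) f (𝓝 0) := by
    simpa [Measure.real, Function.comp_def] using (ENNReal.tendsto_toReal ENNReal.zero_ne_top).comp hB
  filter_upwards [hBreal.eventually_lt_const (half_pos hε)] with i hi
  have hbound : ∀ ω, ‖G (M i ω) - G K‖ ≤ ε / 2 + (B i).indicator (fun _ ↦ (1 : ℝ)) ω := by
    intro ω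
    by_cases hω : ω ∈ B i
    · rw [Set.indicator_of_mem hω, Real.norm_eq_abs, abs_le]
      have h1 := hG i ω
      constructor <;> linarith [h1.1, h1.2, hGK.1, hGK.2]
    · rw [Set.indicator_of_notMem hω, add_zero]
      refine (hball (x := M i ω) ?_).le
      simp only [B, Set.mem_iUnion, Set.mem_ofPred_eq, not_exists, not_le] at hω
      refine (dist_pi_lt_iff hδ).2 fun a ↦ (dist_pi_lt_iff hδ).2 fun b ↦ ?_
      rw [Real.dist_eq]
      exact hω a b
  have hGint : Integrable (fun ω ↦ G (M i ω)) (P i) :=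
    (integrable_const (1 : ℝ)).mono' (hGM i) (ae_of_all _ fun ω ↦ by
      rw [Real.norm_eq_abs, abs_of_nonneg (hG i ω).1]; exact (hG i ω).2)
  have hind : Integrable ((B i).indicator fun _ ↦ (1 : ℝ)) (P i) :=
    (integrable_const _).indicator (hBmeas i)
  have hconst : ∫ _ω, G K ∂P i = G K := by simp
  rw [Real.dist_eq, ← Real.norm_eq_abs]
  calc ‖∫ ω, G (M i ω) ∂P i - G K‖ = ‖∫ ω, (G (M i ω) - G K) ∂P i‖ := by
        rw [integral_sub hGint (integrable_const _), hconst]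
    _ ≤ ∫ ω, (ε / 2 + (B i).indicator (fun _ ↦ (1 : ℝ)) ω) ∂P i :=
        norm_integral_le_of_norm_le ((integrable_const _).add hind) (ae_of_all _ hbound)
    _ = ε / 2 + (P i).real (B i) := by
        rw [integral_add (integrable_const _) hind, integral_indicator_const _ (hBmeas i)]
        simp
    _ < ε := by linarith

/-! ### Random linear forms in a standard Gaussian vector -/

section GaussianReadout

variable {m n : ℕ}

theorem hasGaussianLaw_pi_gaussianReal :
    HasGaussianLaw (fun (w : Fin m → ℝ) j ↦ w j) (Measure.pi fun _ ↦ gaussianReal 0 1) := by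
  refine iIndepFun.hasGaussianLaw (X := fun j (w : Fin m → ℝ) ↦ w j) (fun j ↦ ?_)
    (iIndepFun_pi (X := fun _ ↦ id) fun _ ↦ aemeasurable_id)
  refine ⟨?_⟩
  rw [(measurePreserving_eval (fun _ : Fin m ↦ gaussianReal 0 1) j).map_eq]
  infer_instance

theorem memLp_two_eval_pi_gaussianReal (j : Fin m) :
    MemLp (fun w : Fin m → ℝ ↦ w j) 2 (Measure.pi fun _ ↦ gaussianReal 0 1) :=
  (hasGaussianLaw_pi_gaussianReal.eval j).memLp_two

theorem integral_eval_pi_gaussianReal (j : Fin m) :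
    ∫ w : Fin m → ℝ, w j ∂(Measure.pi fun _ ↦ gaussianReal 0 1) = 0 := by
  have h := measurePreserving_eval (fun _ : Fin m ↦ gaussianReal 0 1) j
  have := integral_map (μ := Measure.pi fun _ : Fin m ↦ gaussianReal 0 1) (f := fun x : ℝ ↦ x)
    h.measurable.aemeasurable aestronglyMeasurable_id
  rw [h.map_eq, integral_id_gaussianReal] at this
  exact this.symm

theorem covariance_eval_pi_gaussianReal (j k : Fin m) :
    cov[fun w : Fin m → ℝ ↦ w j, fun w ↦ w k; Measure.pi fun _ ↦ gaussianReal 0 1] =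
      (1 : Matrix (Fin m) (Fin m) ℝ) j k := by
  rcases eq_or_ne j k with rfl | hjk
  · have h := measurePreserving_eval (fun _ : Fin m ↦ gaussianReal 0 1) j
    rw [covariance_self (measurable_pi_apply j).aemeasurable, Matrix.one_apply_eq]
    have := variance_map (μ := Measure.pi fun _ : Fin m ↦ gaussianReal 0 1) (X := fun x : ℝ ↦ x)
      aemeasurable_id h.measurable.aemeasurable
    rw [h.map_eq, variance_fun_id_gaussianReal] at this
    exact this.symm
  · rw [Matrix.one_apply_ne hjk]
    exact ((iIndepFun_pi (μ := fun _ : Fin m ↦ gaussianReal 0 1) (X := fun _ ↦ id)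
      fun _ ↦ aemeasurable_id).indepFun hjk).covariance_eq_zero
      (memLp_two_eval_pi_gaussianReal j) (memLp_two_eval_pi_gaussianReal k)

variable (A : Matrix (Fin n) (Fin m) ℝ)

theorem hasGaussianLaw_sum_mul :
    HasGaussianLaw (fun (w : Fin m → ℝ) a ↦ ∑ j, A a j * w j)
      (Measure.pi fun _ ↦ gaussianReal 0 1) :=
  hasGaussianLaw_pi_gaussianReal.map_fun (Matrix.mulVecLin A).toContinuousLinearMap

theorem integral_sum_mul (a : Fin n) :
    ∫ w : Fin m → ℝ, ∑ j, A a j * w j ∂(Measure.pi fun _ ↦ gaussianReal 0 1) = 0 := by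
  rw [integral_finsetSum _ fun j _ ↦
    ((memLp_two_eval_pi_gaussianReal j).integrable (by norm_num)).const_mul _]
  simp [integral_const_mul, integral_eval_pi_gaussianReal]

theorem covariance_sum_mul (a b : Fin n) :
    cov[fun w : Fin m → ℝ ↦ ∑ j, A a j * w j, fun w ↦ ∑ j, A b j * w j;
      Measure.pi fun _ ↦ gaussianReal 0 1] = (A * A.transpose) a b := by
  rw [covariance_fun_sum_fun_sum (fun j ↦ (memLp_two_eval_pi_gaussianReal j).const_mul _)
    (fun j ↦ (memLp_two_eval_pi_gaussianReal j).const_mul _)]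
  simp [covariance_const_mul_left, covariance_const_mul_right, covariance_eval_pi_gaussianReal,
    Matrix.one_apply, Matrix.mul_apply, mul_comm]

theorem integral_sum_mul_sq (a : Fin n) :
    ∫ w : Fin m → ℝ, (∑ j, A a j * w j) ^ 2 ∂(Measure.pi fun _ ↦ gaussianReal 0 1) =
      (A * A.transpose) a a := by
  have hL : MemLp (fun w : Fin m → ℝ ↦ ∑ j, A a j * w j) 2 (Measure.pi fun _ ↦ gaussianReal 0 1) :=
    memLp_finsetSum _ fun j _ ↦ (memLp_two_eval_pi_gaussianReal j).const_mul _
  rw [← covariance_sum_mul, covariance_eq_sub hL hL, integral_sum_mul]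
  simp [pow_two]

theorem posSemidef_mul_transpose_self : (A * A.transpose).PosSemidef := by
  simpa [Matrix.conjTranspose_eq_transpose_of_trivial] using
    Matrix.posSemidef_self_mul_conjTranspose A

theorem integral_exp_neg_sq_sum_mul {σ : ℝ} (hσ : 0 < σ) (y : Fin n → ℝ) :
    ∫ w : Fin m → ℝ, Real.exp (-(∑ a, (y a - ∑ j, A a j * w j) ^ 2) / (2 * σ ^ 2))
        ∂(Measure.pi fun _ ↦ gaussianReal 0 1) = gaussianEvidence σ y (A * A.transpose) := by
  have h := hasGaussianLaw_sum_mul A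
  have h' := integral_exp_neg_sq_of_hasGaussianLaw (F := fun a (w : Fin m → ℝ) ↦ ∑ j, A a j * w j)
    (S := A * A.transpose) h (integral_sum_mul A) (covariance_sum_mul A)
    (posSemidef_mul_transpose_self A) hσ y
  exact h'

variable {α : Type*} [MeasurableSpace α] {μ : Measure α}
  {Ψ : α → Matrix (Fin n) (Fin m) ℝ}

/-- The entries of row `a` of `Ψ` are square-integrable, as the diagonal entry of `Ψ Ψᵀ` is the sum
of their squares; products of square-integrable functions of independent variables remain so. -/
theorem memLp_two_sum_mul_prod (hΨ : ∀ a j, Measurable fun u ↦ Ψ u a j) {a : Fin n}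
    (hint : Integrable (fun u ↦ (Ψ u * (Ψ u).transpose) a a) μ) :
    MemLp (fun z : α × (Fin m → ℝ) ↦ ∑ j, Ψ z.1 a j * z.2 j) 2
      (μ.prod (Measure.pi fun _ ↦ gaussianReal 0 1)) := by
  refine memLp_finsetSum _ fun j _ ↦ ?_
  have hsq : Integrable (fun u ↦ Ψ u a j ^ 2) μ := by
    refine hint.mono' ((hΨ a j).pow_const 2).aestronglyMeasurable (ae_of_all _ fun u ↦ ?_)
    rw [Real.norm_of_nonneg (sq_nonneg _), Matrix.mul_apply]
    simp only [Matrix.transpose_apply, ← pow_two]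
    exact Finset.single_le_sum (f := fun j ↦ Ψ u a j ^ 2) (fun _ _ ↦ sq_nonneg _)
      (Finset.mem_univ j)
  have hΨ' := hΨ a j
  have hm : Measurable fun z : α × (Fin m → ℝ) ↦ Ψ z.1 a j * z.2 j := by fun_prop
  rw [memLp_two_iff_integrable_sq hm.aestronglyMeasurable]
  simp_rw [mul_pow]
  exact hsq.mul_prod (memLp_two_eval_pi_gaussianReal j).integrable_sq

variable [IsProbabilityMeasure μ]

theorem integral_sum_mul_prod (hΨ : ∀ a j, Measurable fun u ↦ Ψ u a j) {a : Fin n}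
    (hint : Integrable (fun u ↦ (Ψ u * (Ψ u).transpose) a a) μ) :
    ∫ z : α × (Fin m → ℝ), ∑ j, Ψ z.1 a j * z.2 j
      ∂(μ.prod (Measure.pi fun _ ↦ gaussianReal 0 1)) = 0 := by
  rw [integral_prod _ ((memLp_two_sum_mul_prod hΨ hint).integrable (by norm_num))]
  simp_rw [integral_sum_mul]
  simp

theorem integral_sum_mul_prod_sq (hΨ : ∀ a j, Measurable fun u ↦ Ψ u a j) {a : Fin n}
    (hint : Integrable (fun u ↦ (Ψ u * (Ψ u).transpose) a a) μ) :
    ∫ z : α × (Fin m → ℝ), (∑ j, Ψ z.1 a j * z.2 j) ^ 2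
      ∂(μ.prod (Measure.pi fun _ ↦ gaussianReal 0 1)) = ∫ u, (Ψ u * (Ψ u).transpose) a a ∂μ := by
  rw [integral_prod _ (memLp_two_sum_mul_prod hΨ hint).integrable_sq]
  simp_rw [integral_sum_mul_sq]

theorem measurable_exp_neg_sq_sum_mul (hΨ : ∀ a j, Measurable fun u ↦ Ψ u a j) (σ : ℝ)
    (y : Fin n → ℝ) : Measurable fun z : α × (Fin m → ℝ) ↦
      Real.exp (-(∑ a, (y a - ∑ j, Ψ z.1 a j * z.2 j) ^ 2) / (2 * σ ^ 2)) := by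
  fun_prop

theorem integral_exp_neg_sq_sum_mul_prod (hΨ : ∀ a j, Measurable fun u ↦ Ψ u a j) {σ : ℝ}
    (hσ : 0 < σ) (y : Fin n → ℝ) :
    ∫ z : α × (Fin m → ℝ),
        Real.exp (-(∑ a, (y a - ∑ j, Ψ z.1 a j * z.2 j) ^ 2) / (2 * σ ^ 2))
        ∂(μ.prod (Measure.pi fun _ ↦ gaussianReal 0 1)) =
      ∫ u, gaussianEvidence σ y (Ψ u * (Ψ u).transpose) ∂μ := by
  rw [integral_prod]
  · simp_rw [integral_exp_neg_sq_sum_mul _ hσ]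
  · refine (integrable_const (1 : ℝ)).mono'
      (measurable_exp_neg_sq_sum_mul hΨ σ y).aestronglyMeasurable (ae_of_all _ fun z ↦ ?_)
    rw [Real.norm_eq_abs, Real.abs_exp, Real.exp_le_one_iff, neg_div]
    exact neg_nonpos.2 (by positivity)

/-- The evidence inherits its measurability from the integral that it evaluates, which avoids the
measurability of matrix inversion. -/
theorem stronglyMeasurable_gaussianEvidence_mul_transpose
    (hΨ : ∀ a j, Measurable fun u ↦ Ψ u a j) {σ : ℝ} (hσ : 0 < σ) (y : Fin n → ℝ) :
    StronglyMeasurable fun u ↦ gaussianEvidence σ y (Ψ u * (Ψ u).transpose) := by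
  have := (measurable_exp_neg_sq_sum_mul hΨ σ y).stronglyMeasurable.integral_prod_right'
    (ν := Measure.pi fun _ ↦ gaussianReal 0 1)
  simpa only [integral_exp_neg_sq_sum_mul _ hσ] using this

end GaussianReadout

/-! ### The network under the prior -/

namespace BNN

variable {𝒳 : Type*} {H n : ℕ} (N : BNN 𝒳 H)

instance : IsProbabilityMeasure N.prior := by unfold prior; infer_instance

theorem measurable_hidden (x : 𝒳) (ℓ : Fin (H + 1)) : Measurable fun θ ↦ N.hidden θ x ℓ := by
  induction ℓ using WellFoundedLT.induction with
  | ind ℓ ih =>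
    have h : (fun θ ↦ N.hidden θ x ℓ) = (fun q : (Fin (N.numParams ℓ) → ℝ) ×
        ((j : Set.Iio ℓ) → Fin (N.width j) → ℝ) ↦ N.layer ℓ x q.1 q.2) ∘
        fun θ : N.Params ↦ (fun c ↦ θ (Sum.inl ⟨ℓ, c⟩), fun j : Set.Iio ℓ ↦ N.hidden θ x j.1) := by
      funext θ
      rw [hidden]
      rfl
    rw [h]
    refine (N.measurable_layer ℓ x).comp (Measurable.prodMk ?_ ?_)
    · fun_prop
    · exact measurable_pi_lambda _ fun j ↦ ih j.1 j.2

/-- The hidden layers do not see the readout weights. -/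
theorem hidden_congr {θ θ' : N.Params} (h : ∀ s, θ (Sum.inl s) = θ' (Sum.inl s)) (x : 𝒳)
    (ℓ : Fin (H + 1)) : N.hidden θ x ℓ = N.hidden θ' x ℓ := by
  induction ℓ using WellFoundedLT.induction with
  | ind ℓ ih =>
    rw [hidden, hidden]
    congr 1
    · funext c; exact h _
    · funext j; exact ih j.1 j.2

theorem measurable_embeddingMatrix (X : Fin n → 𝒳) (a : Fin n) (j : Fin N.lastWidth) :
    Measurable fun θ ↦ N.embeddingMatrix θ X a j := by
  have h := measurable_pi_iff.1 (N.measurable_hidden (X a) (Fin.last H)) j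
  simp only [embeddingMatrix, Matrix.of_apply, embedding]
  exact h.const_mul _

theorem measurable_empiricalKernel (X : Fin n → 𝒳) (a b : Fin n) :
    Measurable fun θ ↦ N.empiricalKernel θ X a b := by
  simp only [empiricalKernel, Matrix.mul_apply, Matrix.transpose_apply]
  exact Finset.measurable_fun_sum _ fun j _ ↦
    (N.measurable_embeddingMatrix X a j).mul (N.measurable_embeddingMatrix X b j)

theorem posSemidef_empiricalKernel (θ : N.Params) (X : Fin n → 𝒳) :
    (N.empiricalKernel θ X).PosSemidef :=
  posSemidef_mul_transpose_self _

/-- The prior on the parameters of the hidden layers. -/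
noncomputable def hiddenPrior : Measure ((Σ ℓ : Fin (H + 1), Fin (N.numParams ℓ)) → ℝ) :=
  Measure.pi fun _ ↦ gaussianReal 0 1

instance : IsProbabilityMeasure N.hiddenPrior := by unfold hiddenPrior; infer_instance

/-- The parameter vector assembled from the hidden parameters and the readout weights. -/
noncomputable def paramsEquiv :
    ((Σ ℓ : Fin (H + 1), Fin (N.numParams ℓ)) → ℝ) × (Fin N.lastWidth → ℝ) ≃ᵐ N.Params :=
  (MeasurableEquiv.sumPiEquivProdPi fun _ ↦ ℝ).symm

theorem measurePreserving_paramsEquiv :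
    MeasurePreserving N.paramsEquiv
      (N.hiddenPrior.prod (Measure.pi fun _ ↦ gaussianReal 0 1)) N.prior :=
  measurePreserving_sumPiEquivProdPi_symm fun _ ↦ gaussianReal 0 1

/-- The matrix of embeddings as a function of the hidden parameters; the value `0` given to the
readout weights is immaterial. -/
noncomputable def hiddenEmbeddingMatrix (X : Fin n → 𝒳)
    (u : (Σ ℓ : Fin (H + 1), Fin (N.numParams ℓ)) → ℝ) : Matrix (Fin n) (Fin N.lastWidth) ℝ :=
  N.embeddingMatrix (N.paramsEquiv (u, 0)) X

theorem measurable_hiddenEmbeddingMatrix (X : Fin n → 𝒳) (a : Fin n) (j : Fin N.lastWidth) :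
    Measurable fun u ↦ N.hiddenEmbeddingMatrix X u a j :=
  (N.measurable_embeddingMatrix X a j).comp
    (N.paramsEquiv.measurable.comp (measurable_id.prodMk measurable_const))

theorem embeddingMatrix_paramsEquiv (X : Fin n → 𝒳)
    (z : ((Σ ℓ : Fin (H + 1), Fin (N.numParams ℓ)) → ℝ) × (Fin N.lastWidth → ℝ)) :
    N.embeddingMatrix (N.paramsEquiv z) X = N.hiddenEmbeddingMatrix X z.1 := by
  ext a j
  simp only [hiddenEmbeddingMatrix, embeddingMatrix, Matrix.of_apply, embedding]
  rw [N.hidden_congr (θ := N.paramsEquiv z) (θ' := N.paramsEquiv (z.1, 0)) fun s ↦ rfl]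

theorem output_paramsEquiv (X : Fin n → 𝒳) (a : Fin n)
    (z : ((Σ ℓ : Fin (H + 1), Fin (N.numParams ℓ)) → ℝ) × (Fin N.lastWidth → ℝ)) :
    N.output (N.paramsEquiv z) (X a) = ∑ j, N.hiddenEmbeddingMatrix X z.1 a j * z.2 j := by
  rw [← embeddingMatrix_paramsEquiv]
  rfl

theorem integral_prior (f : N.Params → ℝ) :
    ∫ θ, f θ ∂N.prior =
      ∫ z, f (N.paramsEquiv z) ∂(N.hiddenPrior.prod (Measure.pi fun _ ↦ gaussianReal 0 1)) :=
  (N.measurePreserving_paramsEquiv.integral_comp' f).symm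

theorem empiricalKernel_paramsEquiv (X : Fin n → 𝒳)
    (z : ((Σ ℓ : Fin (H + 1), Fin (N.numParams ℓ)) → ℝ) × (Fin N.lastWidth → ℝ)) :
    N.empiricalKernel (N.paramsEquiv z) X =
      N.hiddenEmbeddingMatrix X z.1 * (N.hiddenEmbeddingMatrix X z.1).transpose := by
  rw [empiricalKernel, embeddingMatrix_paramsEquiv]

/-- A function of the empirical kernel is integrated over the hidden parameters alone. -/
theorem integral_comp_empiricalKernel (X : Fin n → 𝒳) (g : Matrix (Fin n) (Fin n) ℝ → ℝ) :
    ∫ θ, g (N.empiricalKernel θ X) ∂N.prior =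
      ∫ u, g (N.hiddenEmbeddingMatrix X u * (N.hiddenEmbeddingMatrix X u).transpose)
        ∂N.hiddenPrior := by
  rw [integral_prior]
  simp_rw [empiricalKernel_paramsEquiv]
  rw [integral_fun_fst (ν := Measure.pi fun _ : Fin N.lastWidth ↦ gaussianReal 0 1)
    (fun u ↦ g (N.hiddenEmbeddingMatrix X u * (N.hiddenEmbeddingMatrix X u).transpose))]
  simp

theorem integrable_hiddenEmbeddingMatrix {X : Fin n → 𝒳} {a : Fin n}
    (hint : Integrable (fun θ ↦ N.empiricalKernel θ X a a) N.prior) :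
    Integrable (fun u ↦ (N.hiddenEmbeddingMatrix X u * (N.hiddenEmbeddingMatrix X u).transpose) a a)
      N.hiddenPrior := by
  have h := (N.measurePreserving_paramsEquiv.integrable_comp_emb
    N.paramsEquiv.measurableEmbedding).2 hint
  simp only [Function.comp_def, empiricalKernel_paramsEquiv] at h
  exact h.of_comp_fst (NeZero.ne _)

theorem stronglyMeasurable_gaussianEvidence_empiricalKernel {σ : ℝ} (hσ : 0 < σ) (X : Fin n → 𝒳)
    (y : Fin n → ℝ) :
    StronglyMeasurable fun θ ↦ gaussianEvidence σ y (N.empiricalKernel θ X) :=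
  stronglyMeasurable_gaussianEvidence_mul_transpose (N.measurable_embeddingMatrix X) hσ y

/-- The divergence at finite width: it depends on the network only through the expectations of the
trace and of the evidence of the empirical kernel. -/
theorem klDiv_prior_posterior {σ : ℝ} (hσ : 0 < σ) {X : Fin n → 𝒳} (y : Fin n → ℝ)
    (hint : ∀ a, Integrable (fun θ ↦ N.empiricalKernel θ X a a) N.prior) :
    InformationTheory.klDiv N.prior (N.posterior σ X y) =
      ENNReal.ofReal ((∑ a, y a ^ 2 + ∑ a, ∫ θ, N.empiricalKernel θ X a a ∂N.prior) / (2 * σ ^ 2) +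
        Real.log (∫ θ, gaussianEvidence σ y (N.empiricalKernel θ X) ∂N.prior)) := by
  have hint' := fun a ↦ N.integrable_hiddenEmbeddingMatrix (hint a)
  have hΨ := N.measurable_hiddenEmbeddingMatrix X
  have hL : ∀ a, MemLp (fun θ ↦ N.output θ (X a)) 2 N.prior := by
    intro a
    rw [← N.measurePreserving_paramsEquiv.map_eq,
      N.paramsEquiv.measurableEmbedding.memLp_map_measure_iff]
    simpa only [Function.comp_def, output_paramsEquiv] using memLp_two_sum_mul_prod hΨ (hint' a)
  have hmean : ∀ a, ∫ θ, N.output θ (X a) ∂N.prior = 0 := by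
    intro a
    rw [integral_prior]
    simpa only [output_paramsEquiv] using integral_sum_mul_prod hΨ (hint' a)
  have hsq : ∀ a, ∫ θ, N.output θ (X a) ^ 2 ∂N.prior =
      ∫ θ, N.empiricalKernel θ X a a ∂N.prior := by
    intro a
    rw [integral_prior, N.integral_comp_empiricalKernel X fun M ↦ M a a]
    simpa only [output_paramsEquiv] using integral_sum_mul_prod_sq hΨ (hint' a)
  have hev : ∫ θ, Real.exp (-(∑ a, (y a - N.output θ (X a)) ^ 2) / (2 * σ ^ 2)) ∂N.prior =
      ∫ θ, gaussianEvidence σ y (N.empiricalKernel θ X) ∂N.prior := by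
    rw [integral_prior, N.integral_comp_empiricalKernel X (gaussianEvidence σ y)]
    simpa only [output_paramsEquiv] using integral_exp_neg_sq_sum_mul_prod hΨ hσ y
  rw [posterior, klDiv_gaussianPosterior hL hmean, hev]
  simp_rw [hsq]

end BNN

/-! ### The limit of large widths -/

/-- A limit of expectations of empirical kernels is positive semidefinite. -/
theorem posSemidef_of_tendsto_integral_empiricalKernel {𝒳 ι : Type*} {H n : ℕ} {N : ι → BNN 𝒳 H}
    {X : Fin n → 𝒳} {K : Matrix (Fin n) (Fin n) ℝ} {f : Filter ι} [f.NeBot]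
    (hint : ∀ a b, ∀ᶠ i in f, Integrable (fun θ ↦ (N i).empiricalKernel θ X a b) (N i).prior)
    (hexp : ∀ a b, Tendsto (fun i ↦ ∫ θ, (N i).empiricalKernel θ X a b ∂(N i).prior) f
      (𝓝 (K a b))) : K.PosSemidef := by
  refine Matrix.PosSemidef.of_dotProduct_mulVec_nonneg ?_ fun v ↦ ?_
  · refine Matrix.IsHermitian.ext fun a b ↦ ?_
    refine tendsto_nhds_unique (hexp b a) ((hexp a b).congr fun i ↦ ?_)
    refine integral_congr_ae (ae_of_all _ fun θ ↦ ?_)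
    exact ((N i).posSemidef_empiricalKernel θ X).1.apply b a
  · have hint' : ∀ᶠ i in f, ∀ a b,
        Integrable (fun θ ↦ (N i).empiricalKernel θ X a b) (N i).prior :=
      eventually_all.2 fun a ↦ eventually_all.2 fun b ↦ hint a b
    have hlim : Tendsto (fun i ↦ ∑ a, ∑ b,
        v a * (∫ θ, (N i).empiricalKernel θ X a b ∂(N i).prior) * v b) f
        (𝓝 (∑ a, ∑ b, v a * K a b * v b)) :=
      tendsto_finsetSum _ fun a _ ↦ tendsto_finsetSum _ fun b _ ↦
        ((hexp a b).const_mul _).mul_const _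
    have hquad : ∀ M : Matrix (Fin n) (Fin n) ℝ,
        dotProduct v (M.mulVec v) = ∑ a, ∑ b, v a * M a b * v b := fun M ↦ by
      simp [dotProduct, Matrix.mulVec, Finset.mul_sum, mul_assoc]
    rw [star_trivial, hquad]
    refine ge_of_tendsto hlim (hint'.mono fun i hi ↦ ?_)
    have : ∑ a, ∑ b, v a * (∫ θ, (N i).empiricalKernel θ X a b ∂(N i).prior) * v b =
        ∫ θ, ∑ a, ∑ b, v a * (N i).empiricalKernel θ X a b * v b ∂(N i).prior := by
      rw [integral_finsetSum _ fun a _ ↦ integrable_finsetSum _ fun b _ ↦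
        ((hi a b).const_mul _).mul_const _]
      refine Finset.sum_congr rfl fun a _ ↦ ?_
      rw [integral_finsetSum _ fun b _ ↦ ((hi a b).const_mul _).mul_const _]
      simp_rw [integral_mul_const, integral_const_mul]
    rw [this]
    refine integral_nonneg fun θ ↦ ?_
    have h := ((N i).posSemidef_empiricalKernel θ X).dotProduct_mulVec_nonneg v
    rwa [star_trivial, hquad] at h

theorem proposition3 {𝒳 ι : Type*} {H n : ℕ} (N : ι → BNN 𝒳 H)
    (hN : ∀ m : ℕ, ∃ i, m ≤ (N i).minWidth)
    (σ : ℝ) (hσ : 0 < σ) (X : Fin n → 𝒳) (y : Fin n → ℝ) (K : Matrix (Fin n) (Fin n) ℝ)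
    -- the empirical kernel converges to `K` in probability under the prior
    (hprob : ∀ a b, ∀ ε : ℝ, 0 < ε →
      Tendsto (fun i ↦ (N i).prior {θ | ε ≤ |(N i).empiricalKernel θ X a b - K a b|})
        (comap (fun i ↦ (N i).minWidth) atTop) (𝓝 0))
    -- its expectation exists (for large widths) and converges to `K`
    (hint : ∀ a b, ∀ᶠ i in comap (fun i ↦ (N i).minWidth) atTop,
      Integrable (fun θ ↦ (N i).empiricalKernel θ X a b) (N i).prior)
    (hexp : ∀ a b, Tendsto (fun i ↦ ∫ θ, (N i).empiricalKernel θ X a b ∂(N i).prior)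
      (comap (fun i ↦ (N i).minWidth) atTop) (𝓝 (K a b))) :
    Tendsto (fun i ↦ InformationTheory.klDiv (N i).prior ((N i).posterior σ X y))
        (comap (fun i ↦ (N i).minWidth) atTop) (𝓝 (ENNReal.ofReal (limitKL σ K y))) ∧
      0 ≤ limitKL σ K y ∧
      (K ≠ 0 → limitKL σ K y ≠ 0) ∧
      -- the limit is the divergence of the posterior from the prior of every centred Gaussian
      -- process whose covariance function restricts to `K` on the training inputs
      ∀ (k : 𝒳 → 𝒳 → ℝ) (P : Measure (𝒳 → ℝ)), (∀ a b, k (X a) (X b) = K a b) →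
        IsCenteredGaussianProcessLaw k P →
        InformationTheory.klDiv P (gaussianPosterior P (fun f ↦ f) σ X y) =
          ENNReal.ofReal (limitKL σ K y) := by
  have hne : (comap (fun i ↦ (N i).minWidth) atTop).NeBot := by
    refine comap_neBot_iff.2 fun t ht ↦ ?_
    obtain ⟨m, hm⟩ := mem_atTop_sets.1 ht
    obtain ⟨i, hi⟩ := hN m
    exact ⟨i, hm _ hi⟩
  have hK : K.PosSemidef := posSemidef_of_tendsto_integral_empiricalKernel hint hexp
  refine ⟨?_, limitKL_nonneg hK hσ y, fun hK0 ↦ (limitKL_pos hK hK0 hσ y).ne', ?_⟩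
  · have hZ : Tendsto (fun i ↦ ∫ θ, gaussianEvidence σ y ((N i).empiricalKernel θ X) ∂(N i).prior)
        (comap (fun i ↦ (N i).minWidth) atTop) (𝓝 (gaussianEvidence σ y K)) :=
      tendsto_integral_comp_of_tendsto_measure (fun i ↦ (N i).prior)
        (fun i ↦ (N i).measurable_empiricalKernel X)
        (fun i ↦ ((N i).stronglyMeasurable_gaussianEvidence_empiricalKernel hσ X
          y).aestronglyMeasurable)
        (fun i θ ↦ ⟨(gaussianEvidence_pos ((N i).posSemidef_empiricalKernel θ X) hσ y).le,
          gaussianEvidence_le_one ((N i).posSemidef_empiricalKernel θ X) hσ y⟩)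
        ⟨(gaussianEvidence_pos hK hσ y).le, gaussianEvidence_le_one hK hσ y⟩
        (continuousAt_gaussianEvidence hK hσ y) hprob
    rw [limitKL_eq_add_log_gaussianEvidence hK hσ]
    refine Tendsto.congr' ?_ (ENNReal.tendsto_ofReal
      (((tendsto_const_nhds.add (tendsto_finsetSum Finset.univ fun a _ ↦ hexp a a)).div_const
        (2 * σ ^ 2)).add (hZ.log (gaussianEvidence_pos hK hσ y).ne')))
    filter_upwards [eventually_all.2 fun a ↦ hint a a] with i hi
    exact ((N i).klDiv_prior_posterior hσ y hi).symm
  · intro k P hk hP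
    have hlaw : HasGaussianLaw (fun (f : 𝒳 → ℝ) a ↦ f (X a)) P :=
      ((hP.isGaussianProcess.comp_right X).hasGaussianLaw Finset.univ).map_fun
        (ContinuousLinearMap.pi fun a : Fin n ↦ ContinuousLinearMap.proj
          (φ := fun _ : (Finset.univ : Finset (Fin n)) ↦ ℝ) ⟨a, Finset.mem_univ a⟩)
    exact klDiv_gaussianPosterior_of_hasGaussianLaw hlaw (fun a ↦ hP.mean_eq_zero (X a))
      (fun a b ↦ by rw [hP.covariance_eq, hk]) hK hσ y
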